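/- A \emph{hemiring} is a semiring not required to have a multiplicative identity (addition is a commutative monoid with neutral element $0$, multiplication is associative and distributes over addition, and $0$ is absorbing). It is \emph{congruence-simple} if it is nonzero and its only congruences (equivalence relations compatible with addition and multiplication) are the diagonal and the universal one. The \emph{Boolean semifield} is $\mathbb B=(\{0,1\},\vee,\wedge,0,1)$. Let $\mathcal G$ be a groupoid with source and range maps $s(\alpha)=\alpha^{-1}\alpha$, $r(\alpha)=\alpha\alpha^{-1}$ and unit space $\mathcal G^{(0)}$; the product $\alpha\beta$ is defined iff $r(\beta)=s(\alpha)$. A \emph{topological groupoid} carries a topology for which inversion and composition are continuous. It is \emph{étale} if $\mathcal G^{(0)}$ is locally compact Hausdorff and $s\colon\mathcal G\to\mathcal G^{(0)}$ is a local homeomorphism. An \emph{open bisection} is an open $U\subseteq\mathcal G$ such that $s|_U$ and $r|_U$ are homeomorphisms onto open subsets of $\mathcal G^{(0)}$. An étale groupoid is \emph{ample} if its compact open bisections form a base of its topology. $\mathcal G$ is \emph{minimal} if the only open subsets $D\subseteq\mathcal G^{(0)}$ that are invariant (i.e. $s(\gamma)\in D$ implies $r(\gamma)\in D$) are $\varnothing$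 and $\mathcal G^{(0)}$; it is \emph{effective} if the interior of $\{\gamma\in\mathcal G : s(\gamma)=r(\gamma)\}\setminus\mathcal G^{(0)}$ in $\mathcal G$ is empty. For a Hausdorff ample groupoid $\mathcal G$ and a commutative semiring $S$ (with identity), the \emph{Steinberg algebra} $A_S(\mathcal G)$ is the $S$-semimodule of functions $\mathcal G\to S$ spanned by the characteristic functions $1_U$ of the compact open bisections $U$ of $\mathcal G$, with the convolution product $(f*g)(\gamma)=\sum_{\alpha\beta=\gamma}f(\alpha)g(\beta)$ (a finite sum). \textbf{Theorem.} Let $\mathcal G$ be a nonempty Hausdorff ample groupoid and $S$ a commutative semiring. Then $A_S(\mathcal G)$ is congruence-simple if and only if both of the following conditions hold: \begin{enumerate} \item[(1)] $S$ is a field or is isomorphic to the Boolean semifield $\mathbb B$; \item[(2)] $\mathcal G$ is both minimal and effective. \end{enumerate} -/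

import Mathlib

/-! Topological groupoids, Steinberg algebras over commutative semirings, congruence-simplicity. -/

open CategoryTheory

section Groupoids

universe v u

/-- The set of all arrows of a groupoid (given as a small category with object set `C` in which
every morphism is invertible). This set is what is usually denoted `𝒢`. -/
abbrev Arr (C : Type u) [Groupoid.{v} C] : Type max u v := Quiver.Total C

namespace Arr

variable {C : Type u} [Groupoid.{v} C]

/-- The identity arrow at the object `x`. -/
def unit (x : C) : Arr C := ⟨x, x, 𝟙 x⟩

variable (C) in
/-- The unit space `𝒢⁽⁰⁾`, as a subset of the set of arrows. -/
def unitSpace : Set (Arr C) := Set.range unit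

/-- The source map `s : 𝒢 → 𝒢⁽⁰⁾`. -/
def src (a : Arr C) : unitSpace C := ⟨unit a.left, a.left, rfl⟩

/-- The range map `r : 𝒢 → 𝒢⁽⁰⁾`. -/
def rng (a : Arr C) : unitSpace C := ⟨unit a.right, a.right, rfl⟩

variable (C) in
/-- The set `𝒢⁽²⁾` of composable pairs `(α, β)`, those with `r(β) = s(α)`. -/
abbrev Composable : Type max u v := {p : Arr C × Arr C // rng p.2 = src p.1}

lemma unit_injective : Function.Injective (unit : C → Arr C) := fun _ _ h =>
  congrArg Quiver.Total.left h

lemma right_eq_left {a b : Arr C} (h : rng b = src a) : b.right = a.left :=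
  unit_injective (congrArg Subtype.val h)

/-- The product `αβ` of a composable pair (first `β`, then `α`). -/
def comp (p : Composable C) : Arr C :=
  ⟨p.1.2.left, p.1.1.right, p.1.2.hom ≫ eqToHom (right_eq_left p.2) ≫ p.1.1.hom⟩

/-- The inverse `α⁻¹`. -/
def inv (a : Arr C) : Arr C := ⟨a.right, a.left, Groupoid.inv a.hom⟩

/-- The product `UV` of two sets of arrows. -/
def setMul (U V : Set (Arr C)) : Set (Arr C) :=
  {γ | ∃ p : Composable C, p.1.1 ∈ U ∧ p.1.2 ∈ V ∧ comp p = γ}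

/-! Basic identities in a groupoid. -/

@[simp] lemma src_comp (p : Composable C) : src (comp p) = src p.1.2 := rfl
@[simp] lemma rng_comp (p : Composable C) : rng (comp p) = rng p.1.1 := rfl
@[simp] lemma src_inv (a : Arr C) : src (inv a) = rng a := rfl
@[simp] lemma rng_inv (a : Arr C) : rng (inv a) = src a := rfl

@[simp] lemma inv_inv (a : Arr C) : inv (inv a) = a := by
  simp [inv]

lemma comp_assoc (a b c : Arr C) (hab : rng b = src a) (hbc : rng c = src b) :
    comp ⟨(comp ⟨(a, b), hab⟩, c), hbc⟩ = comp ⟨(a, comp ⟨(b, c), hbc⟩), hab⟩ := by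
  simp [comp]

lemma inv_comp_self (a : Arr C) : comp ⟨(inv a, a), rfl⟩ = (src a : Arr C) := by
  simp [comp, inv, src, unit]

lemma self_comp_inv (a : Arr C) : comp ⟨(a, inv a), rfl⟩ = (rng a : Arr C) := by
  simp [comp, inv, rng, unit]

lemma unit_comp (a : Arr C) : comp ⟨((rng a : Arr C), a), rfl⟩ = a := by
  simp [comp, rng, unit]

lemma comp_unit (a : Arr C) : comp ⟨(a, (src a : Arr C)), rfl⟩ = a := by
  simp [comp, src, unit]

lemma inv_comp_comp (a b : Arr C) (h : rng b = src a) :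
    comp ⟨(inv a, comp ⟨(a, b), h⟩), rfl⟩ = b := by
  obtain ⟨x, y, f⟩ := a
  obtain ⟨z, w, g⟩ := b
  obtain rfl : w = x := right_eq_left h
  simp [comp, inv]

lemma comp_inv_comp (a c : Arr C) (h : rng c = rng a) :
    comp ⟨(a, comp ⟨(inv a, c), h⟩), rfl⟩ = c := by
  obtain ⟨x, y, f⟩ := a
  obtain ⟨z, w, g⟩ := c
  obtain rfl : w = y := unit_injective (congrArg Subtype.val h)
  simp [comp, inv]

/-- A product and its left factor determine the right factor. -/
lemma pair_ext {p q : Composable C} (h : comp p = comp q) (h1 : p.1.1 = q.1.1) : p = q := by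
  obtain ⟨⟨a, b⟩, hab⟩ := p
  obtain ⟨⟨a', b'⟩, hab'⟩ := q
  obtain rfl : a = a' := h1
  have e1 := inv_comp_comp a b hab
  have e2 := inv_comp_comp a b' hab'
  have : b = b' := by
    rw [← e1, ← e2]; congr 4
  subst this
  rfl

lemma setMul_assoc (U V W : Set (Arr C)) :
    setMul (setMul U V) W = setMul U (setMul V W) := by
  ext γ
  constructor
  · rintro ⟨⟨⟨_, c⟩, hc⟩, ⟨⟨⟨a, b⟩, hab⟩, ha, hb, rfl⟩, hcW, rfl⟩
    exact ⟨⟨(a, comp ⟨(b, c), hc⟩), hab⟩, ha, ⟨⟨(b, c), hc⟩, hb, hcW, rfl⟩,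
      (comp_assoc a b c hab hc).symm⟩
  · rintro ⟨⟨⟨a, _⟩, ha'⟩, ha, ⟨⟨⟨b, c⟩, hbc⟩, hb, hcW, rfl⟩, rfl⟩
    exact ⟨⟨(comp ⟨(a, b), ha'⟩, c), hbc⟩, ⟨⟨(a, b), ha'⟩, ha, hb, rfl⟩, hcW,
      comp_assoc a b c ha' hbc⟩

end Arr

open Arr Topology

section Topological

variable (C : Type u) [Groupoid.{v} C] [TopologicalSpace (Arr C)]

/-- A topological groupoid: inversion is continuous, and so is composition, with respect to the
topology on the set of composable pairs induced by the product topology. -/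
class IsTopGroupoid : Prop where
  continuous_inv : Continuous (Arr.inv : Arr C → Arr C)
  continuous_comp : Continuous (Arr.comp : Composable C → Arr C)

/-- An étale groupoid: a topological groupoid with locally compact Hausdorff unit space whose
source map `s : 𝒢 → 𝒢⁽⁰⁾` is a local homeomorphism. -/
class IsEtaleGroupoid : Prop extends IsTopGroupoid C where
  locallyCompact_unitSpace : LocallyCompactSpace (unitSpace C)
  t2_unitSpace : T2Space (unitSpace C)
  isLocalHomeomorph_src : IsLocalHomeomorph (src : Arr C → unitSpace C)

variable {C}

/-- An open bisection: an open set `U` of arrows such that `s` and `r` restrict to homeomorphisms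
of `U` onto open subsets of the unit space. -/
structure IsOpenBisection (U : Set (Arr C)) : Prop where
  isOpen : IsOpen U
  src_embedding : IsOpenEmbedding (fun a : U => src (a : Arr C))
  rng_embedding : IsOpenEmbedding (fun a : U => rng (a : Arr C))

/-- A compact open bisection. -/
structure IsCompactOpenBisection (U : Set (Arr C)) : Prop extends IsOpenBisection U where
  isCompact : IsCompact U

variable (C)

/-- An ample groupoid: an étale groupoid whose topology has a base of compact open bisections. -/
class IsAmpleGroupoid : Prop extends IsEtaleGroupoid C where
  isTopologicalBasis : TopologicalSpace.IsTopologicalBasis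
    {U : Set (Arr C) | IsCompactOpenBisection U}

/-- The groupoid is minimal: its unit space has no open invariant subsets other than the empty set
and the whole unit space. -/
def IsMinimalGroupoid : Prop :=
  ∀ D : Set (unitSpace C), IsOpen D → (∀ γ : Arr C, src γ ∈ D → rng γ ∈ D) →
    D = ∅ ∨ D = Set.univ

/-- The groupoid is effective: the interior of `Iso(𝒢) \ 𝒢⁽⁰⁾` is empty. -/
def IsEffectiveGroupoid : Prop :=
  interior ({γ : Arr C | src γ = rng γ} \ unitSpace C) = ∅

end Topological

/-! Products of compact open bisections are compact open bisections. -/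

section Product

variable {C : Type u} [Groupoid.{v} C] [TopologicalSpace (Arr C)]

lemma continuous_src [IsEtaleGroupoid C] : Continuous (src : Arr C → unitSpace C) :=
  IsEtaleGroupoid.isLocalHomeomorph_src.continuous

lemma isOpenMap_src [IsEtaleGroupoid C] : IsOpenMap (src : Arr C → unitSpace C) :=
  IsEtaleGroupoid.isLocalHomeomorph_src.isOpenMap

lemma continuous_rng [IsEtaleGroupoid C] : Continuous (rng : Arr C → unitSpace C) :=
  (continuous_src (C := C)).comp IsTopGroupoid.continuous_inv

lemma isOpenMap_rng [IsEtaleGroupoid C] : IsOpenMap (rng : Arr C → unitSpace C) := by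
  have h : IsOpenMap (Arr.inv : Arr C → Arr C) := fun U hU => by
    have : Arr.inv '' U = Arr.inv ⁻¹' U := by
      ext a
      exact ⟨by rintro ⟨b, hb, rfl⟩; simpa using hb, fun ha => ⟨_, ha, by simp⟩⟩
    rw [this]
    exact hU.preimage IsTopGroupoid.continuous_inv
  exact (isOpenMap_src (C := C)).comp h

lemma IsOpenBisection.src_inj {U : Set (Arr C)} (hU : IsOpenBisection U) {a b : Arr C}
    (ha : a ∈ U) (hb : b ∈ U) (h : src a = src b) : a = b :=
  congrArg Subtype.val (hU.src_embedding.injective (a₁ := ⟨a, ha⟩) (a₂ := ⟨b, hb⟩) h)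

lemma IsOpenBisection.rng_inj {U : Set (Arr C)} (hU : IsOpenBisection U) {a b : Arr C}
    (ha : a ∈ U) (hb : b ∈ U) (h : rng a = rng b) : a = b :=
  congrArg Subtype.val (hU.rng_embedding.injective (a₁ := ⟨a, ha⟩) (a₂ := ⟨b, hb⟩) h)

/-- In an étale groupoid, an open set on which `s` and `r` are injective is an open bisection. -/
lemma isOpenBisection_of_injOn [IsEtaleGroupoid C] {U : Set (Arr C)} (hU : IsOpen U)
    (hs : ∀ a ∈ U, ∀ b ∈ U, src a = src b → a = b)
    (hr : ∀ a ∈ U, ∀ b ∈ U, rng a = rng b → a = b) : IsOpenBisection U where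
  isOpen := hU
  src_embedding := .of_continuous_injective_isOpenMap
    (continuous_src.comp continuous_subtype_val)
    (fun a b h => Subtype.ext (hs a a.2 b b.2 h)) (isOpenMap_src.comp hU.isOpenMap_subtype_val)
  rng_embedding := .of_continuous_injective_isOpenMap
    (continuous_rng.comp continuous_subtype_val)
    (fun a b h => Subtype.ext (hr a a.2 b b.2 h)) (isOpenMap_rng.comp hU.isOpenMap_subtype_val)

/-- The decomposition of an element of `UV` is unique if `U` is a bisection. -/
lemma IsOpenBisection.pair_unique {U : Set (Arr C)} (hU : IsOpenBisection U) {p q : Composable C}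
    (hp : p.1.1 ∈ U) (hq : q.1.1 ∈ U) (h : comp p = comp q) : p = q := by
  refine pair_ext h (hU.rng_inj hp hq ?_)
  rw [← rng_comp, h, rng_comp]

lemma IsOpenBisection.isOpen_setMul [IsEtaleGroupoid C] {U V : Set (Arr C)}
    (hU : IsOpenBisection U) (hV : IsOpenBisection V) : IsOpen (setMul U V) := by
  let e := hU.rng_embedding.toIsEmbedding.toHomeomorph
  let R : Set (unitSpace C) := Set.range (fun a : U => rng (a : Arr C))
  have hW : IsOpen (rng ⁻¹' R) := hU.rng_embedding.isOpen_range.preimage continuous_rng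
  let σ : (rng ⁻¹' R : Set (Arr C)) → U := fun γ => e.symm ⟨rng γ.1, γ.2⟩
  have hσ : ∀ γ, rng (σ γ : Arr C) = rng γ.1 := fun γ =>
    congrArg Subtype.val (e.apply_symm_apply ⟨rng γ.1, γ.2⟩)
  have hσc : Continuous σ := e.symm.continuous.comp
    ((continuous_rng.comp continuous_subtype_val).subtype_mk _)
  let F : (rng ⁻¹' R : Set (Arr C)) → Arr C := fun γ =>
    comp ⟨(Arr.inv (σ γ : Arr C), γ.1), (hσ γ).symm⟩
  have hF : Continuous F := by
    refine IsTopGroupoid.continuous_comp.comp (Continuous.subtype_mk ?_ _)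
    exact (IsTopGroupoid.continuous_inv.comp (continuous_subtype_val.comp hσc)).prodMk
      continuous_subtype_val
  have : setMul U V = Subtype.val '' (F ⁻¹' V) := by
    ext γ
    constructor
    · rintro ⟨⟨⟨a, b⟩, hab⟩, ha, hb, rfl⟩
      have hm : comp ⟨(a, b), hab⟩ ∈ (rng ⁻¹' R : Set (Arr C)) := ⟨⟨a, ha⟩, rfl⟩
      refine ⟨⟨_, hm⟩, ?_, rfl⟩
      have h1 : (σ ⟨_, hm⟩ : Arr C) = a := hU.rng_inj (σ ⟨_, hm⟩).2 ha (hσ _)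
      have h2 : F ⟨_, hm⟩ = b := by
        have := inv_comp_comp a b hab
        simp only [F, h1]
        exact this
      change F _ ∈ V
      rw [h2]; exact hb
    · rintro ⟨γ, hγ, rfl⟩
      refine ⟨⟨((σ γ : Arr C), F γ), rfl⟩, (σ γ).2, hγ, ?_⟩
      exact comp_inv_comp _ _ (hσ γ).symm
  rw [this]
  exact hW.isOpenMap_subtype_val _ (hV.isOpen.preimage hF)

lemma isCompact_setMul [IsEtaleGroupoid C] {U V : Set (Arr C)}
    (hU : IsCompact U) (hV : IsCompact V) : IsCompact (setMul U V) := by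
  have : T2Space (unitSpace C) := IsEtaleGroupoid.t2_unitSpace
  have hcl : IsClosed {p : Arr C × Arr C | rng p.2 = src p.1} :=
    isClosed_eq (continuous_rng.comp continuous_snd) (continuous_src.comp continuous_fst)
  have hK : IsCompact (Subtype.val ⁻¹' (U ×ˢ V) : Set (Composable C)) :=
    hcl.isClosedEmbedding_subtypeVal.isCompact_preimage (hU.prod hV)
  have : setMul U V = comp '' (Subtype.val ⁻¹' (U ×ˢ V) : Set (Composable C)) := by
    ext γ
    constructor
    · rintro ⟨p, h1, h2, h3⟩
      exact ⟨p, ⟨h1, h2⟩, h3⟩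
    · rintro ⟨p, ⟨h1, h2⟩, h3⟩
      exact ⟨p, h1, h2, h3⟩
  rw [this]
  exact hK.image IsTopGroupoid.continuous_comp

lemma IsCompactOpenBisection.setMul [IsEtaleGroupoid C] {U V : Set (Arr C)}
    (hU : IsCompactOpenBisection U) (hV : IsCompactOpenBisection V) :
    IsCompactOpenBisection (setMul U V) where
  toIsOpenBisection := by
    refine isOpenBisection_of_injOn
      (hU.toIsOpenBisection.isOpen_setMul hV.toIsOpenBisection) ?_ ?_
    · rintro _ ⟨⟨⟨a, b⟩, hab⟩, ha, hb, rfl⟩ _ ⟨⟨⟨a', b'⟩, hab'⟩, ha', hb', rfl⟩ h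
      obtain rfl : b = b' := hV.src_inj hb hb' h
      obtain rfl : a = a' := hU.src_inj ha ha' (hab.symm.trans hab')
      rfl
    · rintro _ ⟨⟨⟨a, b⟩, hab⟩, ha, hb, rfl⟩ _ ⟨⟨⟨a', b'⟩, hab'⟩, ha', hb', rfl⟩ h
      obtain rfl : a = a' := hU.rng_inj ha ha' h
      obtain rfl : b = b' := hV.rng_inj hb hb' (hab.trans hab'.symm)
      rfl
  isCompact := isCompact_setMul hU.isCompact hV.isCompact

end Product

/-! The Steinberg algebra. -/

section Steinberg

universe w

section Convolution

variable {S : Type w} [CommSemiring S] {C : Type u} [Groupoid.{v} C]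

/-- The convolution `(f ∗ g)(γ) = ∑_{γ = αβ} f(α) g(β)`, summed over the composable pairs `(α, β)`
with product `γ`; for `f`, `g` in the Steinberg algebra only finitely many terms are nonzero, see
`finite_convolution_support`. -/
noncomputable def convolution (f g : Arr C → S) (γ : Arr C) : S :=
  ∑ᶠ p : {p : Composable C // comp p = γ}, f p.1.1.1 * g p.1.1.2

lemma zero_convolution (g : Arr C → S) : convolution (0 : Arr C → S) g = 0 := by
  funext γ
  simp [convolution]

lemma convolution_zero (f : Arr C → S) : convolution f (0 : Arr C → S) = 0 := by
  funext γ
  simp [convolution]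

end Convolution

variable (S : Type w) [CommSemiring S] (C : Type u) [Groupoid.{v} C] [TopologicalSpace (Arr C)]

/-- The Steinberg algebra `A_S(𝒢)` as a semimodule: the `S`-span, among the functions `𝒢 → S`, of
the characteristic functions `1_U` of the compact open bisections `U`. (For Hausdorff `𝒢` these
functions are continuous for the discrete topology on `S`, see `isLocallyConstant_of_mem`.) -/
def steinbergAlgebra : Submodule S (Arr C → S) :=
  Submodule.span S {f | ∃ U : Set (Arr C), IsCompactOpenBisection U ∧
    f = U.indicator (fun _ => (1 : S))}

variable {S C}

lemma indicator_mem_steinbergAlgebra {U : Set (Arr C)} (hU : IsCompactOpenBisection U) :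
    U.indicator (fun _ => (1 : S)) ∈ steinbergAlgebra S C :=
  Submodule.subset_span ⟨U, hU, rfl⟩

lemma isLocallyConstant_of_mem [T2Space (Arr C)] {f : Arr C → S}
    (hf : f ∈ steinbergAlgebra S C) : IsLocallyConstant f := by
  induction hf using Submodule.span_induction with
  | mem f h =>
    obtain ⟨U, hU, rfl⟩ := h
    exact (LocallyConstant.charFn S
      (⟨hU.isCompact.isClosed, hU.isOpen⟩ : IsClopen U)).isLocallyConstant
  | zero => exact IsLocallyConstant.const 0
  | add f g _ _ hf hg => exact hf.add hg
  | smul c f _ hf => exact hf.comp (fun x => c • x)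

lemma finite_fiber_of_mem {f : Arr C → S} (hf : f ∈ steinbergAlgebra S C) (x : unitSpace C) :
    {a | rng a = x ∧ f a ≠ 0}.Finite := by
  induction hf using Submodule.span_induction with
  | mem f h =>
    obtain ⟨U, hU, rfl⟩ := h
    refine Set.Subsingleton.finite ?_
    rintro a ⟨ha, ha'⟩ b ⟨hb, hb'⟩
    exact hU.rng_inj (Set.mem_of_indicator_ne_zero ha') (Set.mem_of_indicator_ne_zero hb')
      (ha.trans hb.symm)
  | zero => simp
  | add f g _ _ hf hg =>
    refine (hf.union hg).subset ?_
    rintro a ⟨ha, ha'⟩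
    by_cases h : f a = 0
    · exact Or.inr ⟨ha, fun h' => ha' (by simp [h, h'])⟩
    · exact Or.inl ⟨ha, h⟩
  | smul c f _ hf =>
    refine hf.subset ?_
    rintro a ⟨ha, ha'⟩
    exact ⟨ha, fun h => ha' (by simp [h])⟩

/-- The sum defining the convolution is finite. -/
lemma finite_convolution_support {f : Arr C → S} (hf : f ∈ steinbergAlgebra S C) (g : Arr C → S)
    (γ : Arr C) :
    (Function.support fun p : {p : Composable C // comp p = γ} =>
      f p.1.1.1 * g p.1.1.2).Finite := by
  have hinj : Function.Injective (fun p : {p : Composable C // comp p = γ} => p.1.1.1) :=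
    fun p q h => Subtype.ext (pair_ext (p.2.trans q.2.symm) h)
  refine ((finite_fiber_of_mem hf (rng γ)).preimage hinj.injOn).subset ?_
  intro p hp
  refine ⟨?_, fun h => hp (by simp only [h, zero_mul])⟩
  exact (congrArg rng p.2 : rng (comp p.1) = rng γ)

lemma convolution_add_left {f f' : Arr C → S} (hf : f ∈ steinbergAlgebra S C)
    (hf' : f' ∈ steinbergAlgebra S C) (g : Arr C → S) :
    convolution (f + f') g = convolution f g + convolution f' g := by
  funext γ
  simp only [convolution, Pi.add_apply, add_mul]
  exact finsum_add_distrib (finite_convolution_support hf g γ) (finite_convolution_support hf' g γ)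

lemma convolution_add_right {f : Arr C → S} (hf : f ∈ steinbergAlgebra S C) (g g' : Arr C → S) :
    convolution f (g + g') = convolution f g + convolution f g' := by
  funext γ
  simp only [convolution, Pi.add_apply, mul_add]
  exact finsum_add_distrib (finite_convolution_support hf g γ) (finite_convolution_support hf g' γ)

lemma convolution_smul_left (c : S) {f : Arr C → S} (hf : f ∈ steinbergAlgebra S C)
    (g : Arr C → S) : convolution (c • f) g = c • convolution f g := by
  funext γ
  simp only [convolution, Pi.smul_apply, smul_eq_mul, mul_assoc]
  exact (mul_finsum' _ c (finite_convolution_support hf g γ)).symm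

lemma convolution_smul_right (c : S) {f : Arr C → S} (hf : f ∈ steinbergAlgebra S C)
    (g : Arr C → S) : convolution f (c • g) = c • convolution f g := by
  funext γ
  simp only [convolution, Pi.smul_apply, smul_eq_mul, mul_left_comm _ c]
  exact (mul_finsum' _ c (finite_convolution_support hf g γ)).symm

/-- `1_U ∗ 1_V = 1_{UV}` for compact open bisections. -/
lemma convolution_indicator {U V : Set (Arr C)} (hU : IsCompactOpenBisection U) :
    convolution (U.indicator fun _ => (1 : S)) (V.indicator fun _ => (1 : S)) =
      (Arr.setMul U V).indicator fun _ => (1 : S) := by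
  classical
  funext γ
  by_cases hγ : γ ∈ Arr.setMul U V
  · rw [Set.indicator_of_mem hγ]
    obtain ⟨p, h1, h2, h3⟩ := hγ
    rw [convolution, finsum_eq_single _ ⟨p, h3⟩]
    · simp [h1, h2]
    · intro q hq
      by_cases hqU : q.1.1.1 ∈ U
      · exact absurd (Subtype.ext (hU.pair_unique hqU h1 (q.2.trans h3.symm))) hq
      · simp [hqU]
  · rw [Set.indicator_of_notMem hγ, convolution]
    refine finsum_eq_zero_of_forall_eq_zero fun q => ?_
    by_cases hqU : q.1.1.1 ∈ U
    · have : q.1.1.2 ∉ V := fun h => hγ ⟨q.1, hqU, h, q.2⟩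
      simp [this]
    · simp [hqU]

lemma convolution_mem [IsEtaleGroupoid C] {f g : Arr C → S} (hf : f ∈ steinbergAlgebra S C)
    (hg : g ∈ steinbergAlgebra S C) : convolution f g ∈ steinbergAlgebra S C := by
  induction hf using Submodule.span_induction with
  | mem f h =>
    obtain ⟨U, hU, rfl⟩ := h
    have hf := indicator_mem_steinbergAlgebra (S := S) hU
    induction hg using Submodule.span_induction with
    | mem g h =>
      obtain ⟨V, hV, rfl⟩ := h
      rw [convolution_indicator hU]
      exact indicator_mem_steinbergAlgebra (hU.setMul hV)
    | zero => rw [convolution_zero]; exact Submodule.zero_mem _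
    | add g g' _ _ hg hg' => rw [convolution_add_right hf]; exact Submodule.add_mem _ hg hg'
    | smul c g _ hg => rw [convolution_smul_right c hf]; exact Submodule.smul_mem _ c hg
  | zero => rw [zero_convolution]; exact Submodule.zero_mem _
  | add f f' h h' hf hf' => rw [convolution_add_left h h']; exact Submodule.add_mem _ hf hf'
  | smul c f h hf => rw [convolution_smul_left c h]; exact Submodule.smul_mem _ c hf

lemma convolution_assoc [IsEtaleGroupoid C] {f g h : Arr C → S} (hf : f ∈ steinbergAlgebra S C)
    (hg : g ∈ steinbergAlgebra S C) (hh : h ∈ steinbergAlgebra S C) :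
    convolution (convolution f g) h = convolution f (convolution g h) := by
  induction hf using Submodule.span_induction with
  | mem f hf =>
    obtain ⟨U, hU, rfl⟩ := hf
    have hf := indicator_mem_steinbergAlgebra (S := S) hU
    induction hg using Submodule.span_induction with
    | mem g hg =>
      obtain ⟨V, hV, rfl⟩ := hg
      have hg := indicator_mem_steinbergAlgebra (S := S) hV
      induction hh using Submodule.span_induction with
      | mem h hh =>
        obtain ⟨W, hW, rfl⟩ := hh
        rw [convolution_indicator hU, convolution_indicator hV,
          convolution_indicator (hU.setMul hV), convolution_indicator hU, setMul_assoc]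
      | zero => simp only [convolution_zero]
      | add h h' _ _ ih ih' =>
        rw [convolution_add_right (convolution_mem hf hg), convolution_add_right hg,
          convolution_add_right hf, ih, ih']
      | smul c h _ ih =>
        rw [convolution_smul_right c (convolution_mem hf hg), convolution_smul_right c hg,
          convolution_smul_right c hf, ih]
    | zero => simp only [convolution_zero, zero_convolution]
    | add g g' hg hg' ih ih' =>
      rw [convolution_add_right hf, convolution_add_left (convolution_mem hf hg)
        (convolution_mem hf hg'), convolution_add_left hg hg', convolution_add_right hf, ih, ih']
    | smul c g hg ih =>
      rw [convolution_smul_right c hf, convolution_smul_left c (convolution_mem hf hg),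
        convolution_smul_left c hg, convolution_smul_right c hf, ih]
  | zero => simp only [zero_convolution]
  | add f f' hf hf' ih ih' =>
    rw [convolution_add_left hf hf', convolution_add_left (convolution_mem hf hg)
      (convolution_mem hf' hg), convolution_add_left hf hf', ih, ih']
  | smul c f hf ih =>
    rw [convolution_smul_left c hf, convolution_smul_left c (convolution_mem hf hg),
      convolution_smul_left c hf, ih]

/-- The Steinberg algebra is a (not necessarily unital) semiring under pointwise addition and
convolution. -/
noncomputable instance steinbergAlgebra.instNonUnitalSemiring [IsEtaleGroupoid C] :
    NonUnitalSemiring (steinbergAlgebra S C) :=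
  { (inferInstance : AddCommMonoid (steinbergAlgebra S C)) with
    mul := fun f g => ⟨convolution f.1 g.1, convolution_mem f.2 g.2⟩
    left_distrib := fun f g h => Subtype.ext (convolution_add_right f.2 g.1 h.1)
    right_distrib := fun f g h => Subtype.ext (convolution_add_left f.2 g.2 h.1)
    zero_mul := fun f => Subtype.ext (zero_convolution f.1)
    mul_zero := fun f => Subtype.ext (convolution_zero f.1)
    mul_assoc := fun f g h => Subtype.ext (convolution_assoc f.2 g.2 h.2) }

/-- Scalars can be pulled out of products: the Steinberg algebra is an `S`-algebra. -/
instance steinbergAlgebra.instIsScalarTower [IsEtaleGroupoid C] :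
    IsScalarTower S (steinbergAlgebra S C) (steinbergAlgebra S C) :=
  ⟨fun c f g => Subtype.ext (convolution_smul_left c f.2 g.1)⟩

instance steinbergAlgebra.instSMulCommClass [IsEtaleGroupoid C] :
    SMulCommClass S (steinbergAlgebra S C) (steinbergAlgebra S C) :=
  ⟨fun c f g => Subtype.ext (convolution_smul_right c f.2 g.1).symm⟩

end Steinberg

end Groupoids

/-- A hemiring (a semiring that need not have an identity) is congruence-simple if it is nonzero
and its only congruences are the diagonal one `⊥` and the universal one `⊤`. -/
def IsCongruenceSimple (R : Type*) [NonUnitalSemiring R] : Prop :=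
  Nontrivial R ∧ ∀ ρ : RingCon R, ρ = ⊥ ∨ ρ = ⊤

/-- The commutative semiring `S` is a field. (Mathlib's `IsField`, stated for a semiring, only asks
for multiplicative inverses of nonzero elements, that is, for a semifield; additive inverses are
required here as well.) -/
def IsFieldSemiring (S : Type*) [CommSemiring S] : Prop :=
  IsField S ∧ ∀ a : S, ∃ b : S, a + b = 0

/-- The Boolean semifield `𝔹 = ({0, 1}, ∨, ∧, 0, 1)`. -/
def BooleanSemifield : Type := Bool

namespace BooleanSemifield

instance : Zero BooleanSemifield := ⟨false⟩
instance : One BooleanSemifield := ⟨true⟩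
instance : Add BooleanSemifield := ⟨or⟩
instance : Mul BooleanSemifield := ⟨and⟩

instance : CommSemiring BooleanSemifield where
  nsmul := nsmulRec
  npow := npowRec
  add_assoc := Bool.or_assoc
  zero_add := Bool.false_or
  add_zero := Bool.or_false
  add_comm := Bool.or_comm
  mul_assoc := Bool.and_assoc
  one_mul := Bool.true_and
  mul_one := Bool.and_true
  mul_comm := Bool.and_comm
  zero_mul := Bool.false_and
  mul_zero := Bool.and_false
  left_distrib := Bool.and_or_distrib_left
  right_distrib := Bool.and_or_distrib_right

end BooleanSemifield

/-!
The proof splits the theorem into two equivalences: `A_S(𝒢)` is congruence-simple iff `S` is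
congruence-simple and `𝒢` is minimal and effective, and a commutative semiring is
congruence-simple iff it is a field or the Boolean semifield
(`isCongruenceSimple_iff_field_or_boolean`).

For the second equivalence, if `S` is congruence-simple, then the kernel congruence of
multiplication by `a ≠ 0` is trivial, so there are no zero divisors. If `1` has a negative, the
Bourne congruence of the ideal `aS` shows that `a` is invertible. Otherwise no nonzero element has
a negative, so `{0}` and its complement are the classes of a congruence, and `S = {0, 1}` with
`1 + 1 = 1`.

Necessity in the first equivalence: a congruence on `S` applied pointwise is a congruence on the
algebra. Moreover the algebra acts by convolution on arbitrary functions `𝒢 → S`, and if it is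
congruence-simple, then every invariant set of functions containing a nonzero one is faithful
(`eq_of_forall_convolution_eq`). A nontrivial open invariant set `D` contradicts this for the
functions vanishing on `s⁻¹(D)`, and a nonempty bisection `U` in `Iso(𝒢) \ 𝒢⁽⁰⁾` contradicts it
for the functions `φ ∘ r`, on which `1_U` and `1_{r(U)}` act in the same way.

Sufficiency: let `ρ` relate `f ≠ g`. After translation by a bisection, `f` and `g` differ at a unit
`x`. Near `x` effectiveness provides a compact open set `V` of units with `1_V f 1_V = f(x) 1_V` and
`1_V g 1_V = g(x) 1_V` (`exists_compression`). Then `ρ` induces on the multiples of `1_V` a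
congruence of `S` relating `f(x) ≠ g(x)`, hence all of `S`, and so `1_V` is congruent to `0`
(`exists_charFn_rel_zero`). By minimality every arrow has a neighbourhood `W` with `1_W` congruent
to `0` (`exists_mem_charFn_rel_zero`), and compactness gives the same for every element of the
algebra. No subtraction is needed, which is why fields and the Boolean semifield are treated alike.
-/

section SteinbergSimplicity

open CategoryTheory Arr Topology

universe u v w

/-! ### Commutative congruence-simple semirings -/

/-- In a congruence-simple hemiring, a congruence relating two distinct elements relates all. -/
lemma IsCongruenceSimple.rel_of_rel {R : Type*} [NonUnitalSemiring R] (h : IsCongruenceSimple R)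
    (ρ : RingCon R) {a b : R} (hne : a ≠ b) (hab : ρ a b) (x y : R) : ρ x y := by
  rcases h.2 ρ with rfl | rfl
  · exact absurd hab hne
  · trivial

lemma isCongruenceSimple_of_rel {R : Type*} [NonUnitalSemiring R] [Nontrivial R]
    (h : ∀ (ρ : RingCon R) (a b : R), a ≠ b → ρ a b → ∀ x, ρ x 0) : IsCongruenceSimple R := by
  refine ⟨‹_›, fun ρ => or_iff_not_imp_left.2 fun hρ => ?_⟩
  have : ∃ a b, a ≠ b ∧ ρ a b := by
    by_contra! hc
    refine hρ (RingCon.ext fun a b => ⟨fun hab => by_contra fun hne => hc a b hne hab, ?_⟩)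
    rintro rfl
    exact ρ.refl _
  obtain ⟨a, b, hne, hab⟩ := this
  exact RingCon.ext fun x y =>
    ⟨fun _ => trivial, fun _ => ρ.trans (h ρ a b hne hab x) (ρ.symm (h ρ a b hne hab y))⟩

section CommSemiring

variable {S : Type*} [CommSemiring S]

/-- The congruence `a * x = a * y` on a commutative semiring. -/
def mulLeftCon (a : S) : RingCon S where
  r x y := a * x = a * y
  iseqv := ⟨fun _ => rfl, fun h => h.symm, fun h h' => h.trans h'⟩
  add' h h' := by simp only [mul_add, h, h']
  mul' {w x y z} h h' := by
    change a * w = a * x at h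
    change a * y = a * z at h'
    rw [← mul_assoc, h, mul_right_comm, mul_assoc, mul_comm y, mul_left_comm, h', mul_left_comm]

/-- The Bourne congruence of an ideal `I`: two elements are related if they become equal after
adding suitable elements of `I`. -/
def bourneCon (I : Ideal S) : RingCon S where
  r x y := ∃ i ∈ I, ∃ j ∈ I, x + i = y + j
  iseqv := by
    refine ⟨fun x => ⟨0, I.zero_mem, 0, I.zero_mem, rfl⟩, ?_, ?_⟩
    · rintro x y ⟨i, hi, j, hj, h⟩
      exact ⟨j, hj, i, hi, h.symm⟩
    · rintro x y z ⟨i, hi, j, hj, h⟩ ⟨k, hk, l, hl, h'⟩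
      refine ⟨i + k, I.add_mem hi hk, l + j, I.add_mem hl hj, ?_⟩
      rw [← add_assoc, h, add_right_comm, h', add_assoc]
  add' := by
    rintro w x y z ⟨i, hi, j, hj, h⟩ ⟨k, hk, l, hl, h'⟩
    refine ⟨i + k, I.add_mem hi hk, j + l, I.add_mem hj hl, ?_⟩
    rw [add_add_add_comm, h, h', add_add_add_comm]
  mul' := by
    rintro w x y z ⟨i, hi, j, hj, h⟩ ⟨k, hk, l, hl, h'⟩
    refine ⟨w * k + i * y + i * k,
      I.add_mem (I.add_mem (I.mul_mem_left _ hk) (I.mul_mem_right _ hi)) (I.mul_mem_left _ hk),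
      x * l + j * z + j * l,
      I.add_mem (I.add_mem (I.mul_mem_left _ hl) (I.mul_mem_right _ hj)) (I.mul_mem_left _ hl), ?_⟩
    calc w * y + (w * k + i * y + i * k) = (w + i) * (y + k) := by ring
      _ = (x + j) * (z + l) := by rw [h, h']
      _ = x * z + (x * l + j * z + j * l) := by ring

variable (S) in
/-- The ideal of additively invertible elements of a commutative semiring. -/
def addInvertibleIdeal : Ideal S where
  carrier := {x | ∃ y, x + y = 0}
  zero_mem' := ⟨0, add_zero 0⟩
  add_mem' := by
    rintro x x' ⟨y, hy⟩ ⟨y', hy'⟩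
    exact ⟨y + y', by rw [add_add_add_comm, hy, hy', add_zero]⟩
  smul_mem' := by
    rintro c x ⟨y, hy⟩
    exact ⟨c * y, by rw [smul_eq_mul, ← mul_add, hy, mul_zero]⟩

/-- If sums and products of nonzero elements are nonzero, then `{0}` and its complement are the
classes of a congruence. -/
def zeroNonzeroCon (hadd : ∀ x y : S, x + y = 0 → x = 0)
    (hmul : ∀ x y : S, x * y = 0 → x = 0 ∨ y = 0) : RingCon S where
  r x y := x = 0 ↔ y = 0
  iseqv := ⟨fun _ => Iff.rfl, fun h => h.symm, fun h h' => h.trans h'⟩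
  add' {w x y z} h h' := by
    have key : ∀ x y : S, x + y = 0 ↔ x = 0 ∧ y = 0 := fun x y =>
      ⟨fun e => ⟨hadd x y e, hadd y x (by rwa [add_comm])⟩, fun ⟨h, h'⟩ => by rw [h, h', add_zero]⟩
    exact (key _ _).trans ((and_congr h h').trans (key _ _).symm)
  mul' {w x y z} h h' := by
    have key : ∀ x y : S, x * y = 0 ↔ x = 0 ∨ y = 0 := fun x y =>
      ⟨hmul x y, fun e => by rcases e with e | e <;> simp [e]⟩
    exact (key _ _).trans ((or_congr h h').trans (key _ _).symm)

/-- A commutative semiring with exactly two elements `0 ≠ 1` and `1 + 1 = 1` is the Boolean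
semifield. -/
lemma nonempty_ringEquiv_booleanSemifield [Nontrivial S] (h : ∀ x : S, x = 0 ∨ x = 1)
    (h11 : (1 : S) + 1 = 1) : Nonempty (S ≃+* BooleanSemifield) := by
  classical
  have b01 : (0 : BooleanSemifield) ≠ 1 := Bool.false_ne_true
  have b11 : (1 : BooleanSemifield) + 1 = 1 := rfl
  have hb : ∀ b : BooleanSemifield, b = 0 ∨ b = 1 := fun b => by cases b <;> simp <;> tauto
  refine ⟨{ toFun := fun x => if x = 0 then 0 else 1
            invFun := fun b => if b = 0 then 0 else 1
            left_inv := fun x => ?_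
            right_inv := fun b => ?_
            map_mul' := fun x y => ?_
            map_add' := fun x y => ?_ }⟩
  · rcases h x with rfl | rfl <;> simp [b01.symm]
  · rcases hb b with rfl | rfl <;> simp [b01.symm]
  · rcases h x with rfl | rfl <;> rcases h y with rfl | rfl <;> simp
  · rcases h x with rfl | rfl <;> rcases h y with rfl | rfl <;> simp [h11, b11]

/-- The classification of commutative congruence-simple semirings with identity. -/
theorem isCongruenceSimple_iff_field_or_boolean :
    IsCongruenceSimple S ↔ IsFieldSemiring S ∨ Nonempty (S ≃+* BooleanSemifield) := by
  constructor
  · intro h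
    have := h.1
    have hmul : ∀ x y : S, x * y = 0 → x = 0 ∨ y = 0 := by
      refine fun x y hxy => or_iff_not_imp_right.2 fun hy => ?_
      have : x * 1 = x * 0 :=
        h.rel_of_rel (mulLeftCon x) hy (show x * y = x * 0 by rw [hxy, mul_zero]) 1 0
      simpa using this
    by_cases hring : ∃ y : S, 1 + y = 0
    · left
      have hneg : ∀ a : S, ∃ b, a + b = 0 := fun a => by
        obtain ⟨y, hy⟩ := hring
        exact ⟨a * y, by rw [← mul_one_add, hy, mul_zero]⟩
      refine ⟨⟨⟨0, 1, zero_ne_one⟩, mul_comm, fun {a} ha => ?_⟩, hneg⟩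
      obtain ⟨i, hi, j, hj, hij⟩ := h.rel_of_rel (bourneCon (Ideal.span {a})) ha
        ⟨0, Submodule.zero_mem _, a, Ideal.mem_span_singleton_self a, by simp⟩ 1 0
      obtain ⟨u, rfl⟩ := Ideal.mem_span_singleton'.1 hi
      obtain ⟨v, rfl⟩ := Ideal.mem_span_singleton'.1 hj
      obtain ⟨w, hw⟩ := hneg u
      refine ⟨v + w, ?_⟩
      calc a * (v + w) = (0 + v * a) + w * a := by ring
        _ = 1 + (u + w) * a := by rw [← hij]; ring
        _ = 1 := by rw [hw, zero_mul, add_zero]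
    · right
      have hadd : ∀ x y : S, x + y = 0 → x = 0 := by
        refine fun x y hxy => by_contra fun hx => hring ?_
        obtain ⟨i, hi, j, hj, hij⟩ := h.rel_of_rel (bourneCon (addInvertibleIdeal S)) hx
          ⟨0, Submodule.zero_mem _, x, ⟨y, hxy⟩, by simp⟩ 1 0
        obtain ⟨k, hk⟩ := hj
        exact ⟨i + k, by rw [← add_assoc, hij, zero_add, hk]⟩
      have h01 : ∀ x : S, x = 0 ∨ x = 1 := by
        refine fun x => or_iff_not_imp_left.2 fun hx => by_contra fun hx1 => ?_
        have : (1 : S) = 0 ↔ (0 : S) = 0 := h.rel_of_rel (zeroNonzeroCon hadd hmul) hx1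
          (show x = 0 ↔ (1 : S) = 0 by simp [hx]) 1 0
        exact one_ne_zero (this.2 rfl)
      exact nonempty_ringEquiv_booleanSemifield h01
        ((h01 (1 + 1)).resolve_left fun e => one_ne_zero (hadd 1 1 e))
  · rintro (⟨hf, hneg⟩ | ⟨⟨e⟩⟩)
    · have : Nontrivial S := ⟨hf.exists_pair_ne⟩
      refine isCongruenceSimple_of_rel fun ρ a b hne hab x => ?_
      obtain ⟨c, hc⟩ := hneg b
      have hac : a + c ≠ 0 := fun h0 => hne <| by
        rw [← add_zero a, ← hc, add_left_comm, h0, add_zero]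
      obtain ⟨d, hd⟩ := hf.mul_inv_cancel hac
      have := ρ.mul (ρ.add hab (ρ.refl c)) (ρ.refl (d * x))
      rwa [hc, zero_mul, ← mul_assoc, hd, one_mul] at this
    · have h01 : ∀ x : S, x = 0 ∨ x = 1 := fun x => by
        have : e x = 0 ∨ e x = 1 := by
          generalize e x = b
          cases b
          exacts [Or.inl rfl, Or.inr rfl]
        exact this.imp (fun h => e.injective (h.trans e.map_zero.symm))
          (fun h => e.injective (h.trans e.map_one.symm))
      have b01 : (0 : BooleanSemifield) ≠ 1 := Bool.false_ne_true
      have : Nontrivial S := ⟨0, 1, fun h => b01 (by rw [← e.map_zero, h, e.map_one])⟩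
      refine isCongruenceSimple_of_rel fun ρ a b hne hab x => ?_
      have h10 : ρ 1 0 := by
        rcases h01 a with rfl | rfl <;> rcases h01 b with rfl | rfl
        exacts [absurd rfl hne, ρ.symm hab, hab, absurd rfl hne]
      simpa using ρ.mul h10 (ρ.refl x)

end CommSemiring

section Groupoid

variable {C : Type u} [Groupoid.{v} C]

/-! ### Units and ranges of arrows -/

@[simp] lemma src_coe (x : unitSpace C) : src (x : Arr C) = x := by
  obtain ⟨_, x, rfl⟩ := x
  rfl

@[simp] lemma rng_coe (x : unitSpace C) : rng (x : Arr C) = x := by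
  obtain ⟨_, x, rfl⟩ := x
  rfl

lemma coe_src_of_mem {a : Arr C} (ha : a ∈ unitSpace C) : (src a : Arr C) = a := by
  obtain ⟨x, rfl⟩ := ha
  rfl

lemma coe_rng_of_mem {a : Arr C} (ha : a ∈ unitSpace C) : (rng a : Arr C) = a := by
  obtain ⟨x, rfl⟩ := ha
  rfl

lemma comp_of_left_mem {a b : Arr C} (h : rng b = src a) (ha : a ∈ unitSpace C) :
    comp ⟨(a, b), h⟩ = b := by
  obtain rfl : (rng b : Arr C) = a := by rw [h, coe_src_of_mem ha]
  exact unit_comp b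

lemma comp_of_right_mem {a b : Arr C} (h : rng b = src a) (hb : b ∈ unitSpace C) :
    comp ⟨(a, b), h⟩ = a := by
  obtain rfl : (src a : Arr C) = b := by rw [← h, coe_rng_of_mem hb]
  exact comp_unit a

/-- The range `r(U)` of a set of arrows, viewed as a set of arrows. -/
def rngSet (U : Set (Arr C)) : Set (Arr C) := {x | ∃ a ∈ U, (rng a : Arr C) = x}

lemma rngSet_subset (U : Set (Arr C)) : rngSet U ⊆ unitSpace C := by
  rintro _ ⟨a, -, rfl⟩
  exact (rng a).2

/-- An arrow with range in `r(U)` factors through `U` on the left. -/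
lemma exists_comp_eq {U : Set (Arr C)} {γ : Arr C} (hγ : (rng γ : Arr C) ∈ rngSet U) :
    ∃ p : Composable C, p.1.1 ∈ U ∧ comp p = γ := by
  obtain ⟨a, ha, h⟩ := hγ
  have h' : rng γ = rng a := (Subtype.ext h).symm
  exact ⟨⟨(a, comp ⟨(Arr.inv a, γ), h'⟩), rfl⟩, ha, comp_inv_comp a γ h'⟩

/-! ### Convolution with characteristic functions of sets of arrows -/

variable {S : Type w} [CommSemiring S]

lemma convolution_indicator_apply_of_notMem {U : Set (Arr C)} (h : Arr C → S) {γ : Arr C}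
    (hγ : (rng γ : Arr C) ∉ rngSet U) :
    convolution (U.indicator fun _ => (1 : S)) h γ = 0 := by
  refine finsum_eq_zero_of_forall_eq_zero fun q => ?_
  have : q.1.1.1 ∉ U := fun hq => hγ ⟨_, hq, congrArg (fun x => (rng x : Arr C)) q.2⟩
  simp [this]

lemma convolution_indicator_unit_apply {V : Set (Arr C)}
    (hV0 : V ⊆ unitSpace C) (h : Arr C → S) (γ : Arr C) [Decidable ((src γ : Arr C) ∈ V)] :
    convolution h (V.indicator fun _ => (1 : S)) γ = if (src γ : Arr C) ∈ V then h γ else 0 := by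
  have key : ∀ q : {p : Composable C // comp p = γ}, q.1.1.2 ∈ V →
      q = ⟨⟨(γ, (src γ : Arr C)), by simp⟩, comp_unit γ⟩ := by
    rintro ⟨⟨⟨a, b⟩, hab⟩, rfl⟩ hb
    refine Subtype.ext (pair_ext (comp_unit _).symm ?_)
    exact (comp_of_right_mem hab (hV0 hb)).symm
  split_ifs with hγ
  · rw [convolution, finsum_eq_single _ ⟨⟨(γ, (src γ : Arr C)), by simp⟩, comp_unit γ⟩]
    · simp [hγ]
    · intro q hq
      have : q.1.1.2 ∉ V := fun h => hq (key q h)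
      simp [this]
  · refine finsum_eq_zero_of_forall_eq_zero fun q => ?_
    have : q.1.1.2 ∉ V := fun h => by
      have e := key q h
      rw [e] at h
      exact hγ h
    simp [this]

variable [TopologicalSpace (Arr C)]

/-! ### The unit space and compact open bisections -/

/-- Near a unit the source map `𝒢 → 𝒢` is injective and fixes the unit, so it maps an arrow `a`
close to the unit and its unit `src a` to the same unit, which forces `a = src a`. -/
lemma isOpen_unitSpace [IsEtaleGroupoid C] : IsOpen (unitSpace C) := by
  refine isOpen_iff_mem_nhds.2 fun x hx => ?_
  obtain ⟨e, hxe, he⟩ := IsEtaleGroupoid.isLocalHomeomorph_src (C := C) x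
  have hc : Continuous fun a : Arr C => (src a : Arr C) :=
    continuous_subtype_val.comp continuous_src
  have h2 : (fun a : Arr C => (src a : Arr C)) ⁻¹' e.source ∈ 𝓝 x := by
    refine hc.continuousAt.preimage_mem_nhds ?_
    simp only [coe_src_of_mem hx]
    exact e.open_source.mem_nhds hxe
  filter_upwards [e.open_source.mem_nhds hxe, h2] with a ha ha'
  have : a = (src a : Arr C) := by
    refine e.injOn ha ha' ?_
    rw [← he]
    simp
  rw [this]
  exact (src a).2

lemma isClosed_unitSpace [IsEtaleGroupoid C] [T2Space (Arr C)] : IsClosed (unitSpace C) := by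
  have : unitSpace C = {a : Arr C | (src a : Arr C) = a} := by
    ext a
    exact ⟨coe_src_of_mem, fun h => by rw [← show _ = a from h]; exact (src a).2⟩
  rw [this]
  exact isClosed_eq (continuous_subtype_val.comp continuous_src) continuous_id

lemma exists_isCompactOpenBisection [IsAmpleGroupoid C] {O : Set (Arr C)} (hO : IsOpen O)
    {a : Arr C} (ha : a ∈ O) : ∃ U, IsCompactOpenBisection U ∧ a ∈ U ∧ U ⊆ O :=
  IsAmpleGroupoid.isTopologicalBasis.exists_subset_of_mem_open ha hO

lemma IsCompactOpenBisection.mono [IsEtaleGroupoid C] {U V : Set (Arr C)}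
    (hU : IsCompactOpenBisection U) (hVU : V ⊆ U) (hV : IsOpen V) (hVc : IsCompact V) :
    IsCompactOpenBisection V where
  toIsOpenBisection := isOpenBisection_of_injOn hV
    (fun _ ha _ hb h => hU.src_inj (hVU ha) (hVU hb) h)
    (fun _ ha _ hb h => hU.rng_inj (hVU ha) (hVU hb) h)
  isCompact := hVc

lemma IsCompactOpenBisection.rngSet [IsEtaleGroupoid C] {U : Set (Arr C)}
    (hU : IsCompactOpenBisection U) : IsCompactOpenBisection (rngSet U) where
  toIsOpenBisection := by
    refine isOpenBisection_of_injOn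
      ((isOpen_unitSpace.isOpenMap_subtype_val.comp isOpenMap_rng) _ hU.isOpen) ?_ ?_
    · rintro _ ⟨a, -, rfl⟩ _ ⟨b, -, rfl⟩ h
      simp only [src_coe] at h
      rw [h]
    · rintro _ ⟨a, -, rfl⟩ _ ⟨b, -, rfl⟩ h
      simp only [rng_coe] at h
      rw [h]
  isCompact := hU.isCompact.image (continuous_subtype_val.comp continuous_rng)

/-- If `V` is contained in a bisection `W`, then `V` is recovered from `W` and the range of `V`. -/
lemma IsOpenBisection.setMul_rngSet {V W : Set (Arr C)} (hW : IsOpenBisection W) (hVW : V ⊆ W) :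
    setMul (rngSet V) W = V := by
  ext γ
  constructor
  · rintro ⟨⟨⟨a, b⟩, hab⟩, ⟨c, hc, rfl⟩, hb, rfl⟩
    rw [comp_of_left_mem hab (rng c).2]
    have : b = c := hW.rng_inj hb (hVW hc) (hab.trans (src_coe _))
    rwa [this]
  · intro hγ
    exact ⟨⟨((rng γ : Arr C), γ), by simp⟩, ⟨γ, hγ, rfl⟩, hVW hγ, unit_comp γ⟩

/-! ### Translation by bisections and associativity -/

section Convolution

/-- Convolution by `1_U` translates along the bisection `U`. -/
lemma convolution_indicator_apply {U : Set (Arr C)} (hU : IsOpenBisection U) (h : Arr C → S)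
    (p : Composable C) (hp : p.1.1 ∈ U) :
    convolution (U.indicator fun _ => (1 : S)) h (comp p) = h p.1.2 := by
  rw [convolution, finsum_eq_single _ ⟨p, rfl⟩]
  · simp [hp]
  · intro q hq
    by_cases hqU : q.1.1.1 ∈ U
    · exact absurd (Subtype.ext (hU.pair_unique hqU hp q.2)) hq
    · simp [hqU]

lemma convolution_unit_indicator_apply {V : Set (Arr C)} (hV : IsOpenBisection V)
    (hV0 : V ⊆ unitSpace C) (h : Arr C → S) (γ : Arr C) [Decidable ((rng γ : Arr C) ∈ V)] :
    convolution (V.indicator fun _ => (1 : S)) h γ = if (rng γ : Arr C) ∈ V then h γ else 0 := by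
  split_ifs with hγ
  · have := convolution_indicator_apply hV h ⟨((rng γ : Arr C), γ), by simp⟩ hγ
    rwa [unit_comp] at this
  · refine convolution_indicator_apply_of_notMem h ?_
    rintro ⟨a, ha, h'⟩
    rw [coe_rng_of_mem (hV0 ha)] at h'
    exact hγ (h' ▸ ha)

/-- Functions on the arrows form a module over the Steinberg algebra: associativity of convolution
needs no condition on the third factor. -/
lemma convolution_convolution [IsEtaleGroupoid C] {f g : Arr C → S}
    (hf : f ∈ steinbergAlgebra S C) (hg : g ∈ steinbergAlgebra S C) (h : Arr C → S) :
    convolution (convolution f g) h = convolution f (convolution g h) := by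
  induction hf using Submodule.span_induction with
  | mem f hf =>
    obtain ⟨U, hU, rfl⟩ := hf
    have hf := indicator_mem_steinbergAlgebra (S := S) hU
    induction hg using Submodule.span_induction with
    | mem g hg =>
      obtain ⟨V, hV, rfl⟩ := hg
      rw [convolution_indicator hU]
      funext γ
      by_cases hγ : (rng γ : Arr C) ∈ rngSet U
      · obtain ⟨⟨⟨a, b⟩, hab⟩, ha, rfl⟩ := exists_comp_eq hγ
        rw [convolution_indicator_apply hU.toIsOpenBisection _ _ ha]
        by_cases hb : (rng b : Arr C) ∈ rngSet V
        · obtain ⟨⟨⟨c, d⟩, hcd⟩, hc, rfl⟩ := exists_comp_eq hb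
          rw [convolution_indicator_apply hV.toIsOpenBisection _ _ hc, ← comp_assoc a c d hab hcd]
          exact convolution_indicator_apply (hU.setMul hV).toIsOpenBisection h
            ⟨(comp ⟨(a, c), hab⟩, d), hcd⟩ ⟨⟨(a, c), hab⟩, ha, hc, rfl⟩
        · rw [convolution_indicator_apply_of_notMem _ hb, convolution_indicator_apply_of_notMem]
          rintro ⟨_, ⟨⟨⟨a', c⟩, hac⟩, ha', hc, rfl⟩, h'⟩
          obtain rfl : a' = a := hU.rng_inj ha' ha (Subtype.ext h')
          exact hb ⟨c, hc, congrArg Subtype.val (hac.trans hab.symm)⟩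
      · rw [convolution_indicator_apply_of_notMem _ hγ, convolution_indicator_apply_of_notMem]
        rintro ⟨_, ⟨⟨⟨a, c⟩, hac⟩, ha, hc, rfl⟩, h'⟩
        exact hγ ⟨a, ha, h'⟩
    | zero => simp only [convolution_zero, zero_convolution]
    | add g g' hg hg' ih ih' =>
      rw [convolution_add_right hf, convolution_add_left (convolution_mem hf hg)
        (convolution_mem hf hg'), convolution_add_left hg hg', convolution_add_right hf, ih, ih']
    | smul c g hg ih =>
      rw [convolution_smul_right c hf, convolution_smul_left c (convolution_mem hf hg),
        convolution_smul_left c hg, convolution_smul_right c hf, ih]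
  | zero => simp only [zero_convolution]
  | add f f' hf hf' ih ih' =>
    rw [convolution_add_left hf hf', convolution_add_left (convolution_mem hf hg)
      (convolution_mem hf' hg), convolution_add_left hf hf', ih, ih']
  | smul c f hf ih =>
    rw [convolution_smul_left c hf, convolution_smul_left c (convolution_mem hf hg),
      convolution_smul_left c hf, ih]

end Convolution

end Groupoid

section Steinberg

variable {S : Type w} [CommSemiring S] {C : Type u} [Groupoid.{v} C] [TopologicalSpace (Arr C)]

variable (S) in
/-- The characteristic function `1_U`, as an element of the Steinberg algebra. -/
noncomputable def charFn {U : Set (Arr C)} (hU : IsCompactOpenBisection U) :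
    steinbergAlgebra S C :=
  ⟨U.indicator fun _ => (1 : S), indicator_mem_steinbergAlgebra hU⟩

lemma charFn_apply_of_mem {U : Set (Arr C)} (hU : IsCompactOpenBisection U) {a : Arr C}
    (ha : a ∈ U) : (charFn S hU).1 a = 1 :=
  Set.indicator_of_mem ha fun _ => (1 : S)

lemma charFn_apply_of_notMem {U : Set (Arr C)} (hU : IsCompactOpenBisection U) {a : Arr C}
    (ha : a ∉ U) : (charFn S hU).1 a = 0 :=
  Set.indicator_of_notMem ha fun _ => (1 : S)

lemma charFn_congr {U V : Set (Arr C)} (h : U = V) (hU : IsCompactOpenBisection U)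
    (hV : IsCompactOpenBisection V) : charFn S hU = charFn S hV := by
  subst h
  rfl

lemma coe_mul_eq_convolution [IsEtaleGroupoid C] (f g : steinbergAlgebra S C) :
    (f * g).1 = convolution f.1 g.1 := rfl

lemma charFn_mul_charFn [IsEtaleGroupoid C] {U V : Set (Arr C)} (hU : IsCompactOpenBisection U)
    (hV : IsCompactOpenBisection V) : charFn S hU * charFn S hV = charFn S (hU.setMul hV) :=
  Subtype.ext (convolution_indicator hU)

/-! ### Simplicity of the coefficient semiring -/

/-- A congruence on the coefficients, applied pointwise to functions. -/
def pointwiseCon [IsEtaleGroupoid C] (σ : RingCon S) : RingCon (steinbergAlgebra S C) where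
  r f g := ∀ γ, σ (f.1 γ) (g.1 γ)
  iseqv := ⟨fun _ _ => σ.refl _, fun h γ => σ.symm (h γ), fun h h' γ => σ.trans (h γ) (h' γ)⟩
  add' h h' γ := σ.add (h γ) (h' γ)
  mul' {w x y z} h h' γ := by
    refine σ.eq.1 ?_
    change σ.mk'.toAddMonoidHom (convolution w.1 y.1 γ) =
      σ.mk'.toAddMonoidHom (convolution x.1 z.1 γ)
    rw [convolution, AddMonoidHom.map_finsum _ (finite_convolution_support w.2 y.1 γ),
      convolution, AddMonoidHom.map_finsum _ (finite_convolution_support x.2 z.1 γ)]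
    exact finsum_congr fun p => σ.eq.2 (σ.mul (h _) (h' _))

lemma exists_nonempty_isCompactOpenBisection [Nonempty C] [IsAmpleGroupoid C] :
    ∃ U : Set (Arr C), IsCompactOpenBisection U ∧ U.Nonempty := by
  obtain ⟨x⟩ := ‹Nonempty C›
  obtain ⟨U, hU, hx, -⟩ := exists_isCompactOpenBisection isOpen_univ (Set.mem_univ (unit x))
  exact ⟨U, hU, _, hx⟩

lemma isCongruenceSimple_coefficients [Nonempty C] [IsAmpleGroupoid C]
    (h : IsCongruenceSimple (steinbergAlgebra S C)) : IsCongruenceSimple S := by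
  obtain ⟨U, hU, a, ha⟩ := exists_nonempty_isCompactOpenBisection (C := C)
  have : Nontrivial S := by
    by_contra hS
    rw [not_nontrivial_iff_subsingleton] at hS
    obtain ⟨f, g, hfg⟩ := h.1.exists_pair_ne
    exact hfg (Subtype.ext (Subsingleton.elim _ _))
  refine isCongruenceSimple_of_rel fun σ b c hne hbc x => ?_
  have hrel : pointwiseCon σ (b • charFn S hU) (c • charFn S hU) := fun γ =>
    σ.mul hbc (σ.refl _)
  have hne' : b • charFn S hU ≠ c • charFn S hU := fun e => hne <| by
    have := congrFun (congrArg Subtype.val e) a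
    change b * (charFn S hU).1 a = c * (charFn S hU).1 a at this
    rwa [charFn_apply_of_mem hU ha, mul_one, mul_one] at this
  have h10 : σ ((charFn S hU).1 a) 0 := h.rel_of_rel _ hne' hrel (charFn S hU) 0 a
  rw [charFn_apply_of_mem hU ha] at h10
  simpa using σ.mul h10 (σ.refl x)

/-! ### Minimality and effectiveness from faithful modules of functions -/

/-- The congruence identifying two elements of the Steinberg algebra that act in the same way, by
convolution from the left, on an invariant set `M` of functions. -/
def actionCon [IsEtaleGroupoid C] (M : Set (Arr C → S))
    (hM : ∀ f ∈ steinbergAlgebra S C, ∀ h ∈ M, convolution f h ∈ M) :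
    RingCon (steinbergAlgebra S C) where
  r f g := ∀ h ∈ M, convolution f.1 h = convolution g.1 h
  iseqv := ⟨fun _ _ _ => rfl, fun e h hh => (e h hh).symm,
    fun e e' h hh => (e h hh).trans (e' h hh)⟩
  add' {f f' g g'} e e' h hh := by
    change convolution (f.1 + g.1) h = convolution (f'.1 + g'.1) h
    rw [convolution_add_left f.2 g.2, convolution_add_left f'.2 g'.2, e h hh, e' h hh]
  mul' {f f' g g'} e e' h hh := by
    change convolution (convolution f.1 g.1) h = convolution (convolution f'.1 g'.1) h
    rw [convolution_convolution f.2 g.2, convolution_convolution f'.2 g'.2, e' h hh,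
      e _ (hM _ g'.2 h hh)]

/-- A congruence-simple Steinberg algebra acts faithfully on every invariant set of functions that
contains a nonzero function. -/
lemma eq_of_forall_convolution_eq [IsAmpleGroupoid C]
    (hA : IsCongruenceSimple (steinbergAlgebra S C)) {M : Set (Arr C → S)}
    (hM : ∀ f ∈ steinbergAlgebra S C, ∀ h ∈ M, convolution f h ∈ M) {h : Arr C → S} (hh : h ∈ M)
    {γ : Arr C} (hγ : h γ ≠ 0) {f g : steinbergAlgebra S C}
    (hfg : ∀ h ∈ M, convolution f.1 h = convolution g.1 h) : f = g := by
  by_contra hne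
  obtain ⟨V, hV, hγV, -⟩ := exists_isCompactOpenBisection isOpen_univ (Set.mem_univ (rng γ : Arr C))
  have h0 : convolution (charFn S hV).1 h = convolution 0 h :=
    hA.rel_of_rel (actionCon M hM) hne hfg (charFn S hV) 0 h hh
  refine hγ ?_
  have h1 := convolution_indicator_apply hV.toIsOpenBisection h ⟨((rng γ : Arr C), γ), by simp⟩ hγV
  rw [unit_comp] at h1
  rw [← h1]
  have := congrFun h0 γ
  rwa [zero_convolution] at this

/-- The algebra acts on the functions that vanish on arrows with source in a given set `D`; if `D`
is open and invariant, then `1_U` acts as zero for every `U` contained in `s⁻¹(D)`. -/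
lemma isMinimalGroupoid_of_isCongruenceSimple [Nontrivial S] [IsAmpleGroupoid C]
    (hA : IsCongruenceSimple (steinbergAlgebra S C)) : IsMinimalGroupoid C := by
  classical
  intro D hD hinv
  by_contra! hne
  obtain ⟨⟨x, hx⟩, hne⟩ := hne
  obtain ⟨y, hy⟩ := (Set.ne_univ_iff_exists_notMem D).1 hne
  obtain ⟨U, hU, hxU, hUD⟩ := exists_isCompactOpenBisection (hD.preimage continuous_src)
    (show (x : Arr C) ∈ src ⁻¹' D by simpa using hx)
  have hM : ∀ f ∈ steinbergAlgebra S C, ∀ h ∈ {h : Arr C → S | ∀ γ, src γ ∈ D → h γ = 0},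
      convolution f h ∈ {h : Arr C → S | ∀ γ, src γ ∈ D → h γ = 0} := by
    intro f _ h hh γ hγ
    refine finsum_eq_zero_of_forall_eq_zero fun q => ?_
    rw [hh q.1.1.2 (by rw [← src_comp, q.2]; exact hγ), mul_zero]
  have hyM : (fun γ => if src γ = y then (1 : S) else 0) ∈
      {h : Arr C → S | ∀ γ, src γ ∈ D → h γ = 0} := fun γ hγ =>
    if_neg fun e : src γ = y => hy (e ▸ hγ)
  have h0 : charFn S hU = 0 := by
    refine eq_of_forall_convolution_eq hA hM hyM (γ := (y : Arr C)) (by simp) fun h hh => ?_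
    funext γ
    change convolution _ h γ = convolution 0 h γ
    rw [zero_convolution]
    by_cases hγ : (rng γ : Arr C) ∈ rngSet U
    · obtain ⟨⟨⟨a, b⟩, hab⟩, ha, rfl⟩ := exists_comp_eq hγ
      refine (convolution_indicator_apply hU.toIsOpenBisection h _ ha).trans (hh b ?_)
      refine hinv (Arr.inv b) ?_
      rw [src_inv, show rng b = src a from hab]
      exact hUD ha
    · exact convolution_indicator_apply_of_notMem _ hγ
  have := congrFun (congrArg Subtype.val h0) x
  rw [charFn_apply_of_mem hU hxU] at this
  exact one_ne_zero this

/-- The algebra acts on the functions of the form `φ ∘ r`, and this action cannot tell `1_U` from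
`1_{r(U)}` if the bisection `U` consists of arrows with equal source and range. -/
lemma isEffectiveGroupoid_of_isCongruenceSimple [Nontrivial S] [IsAmpleGroupoid C]
    (hA : IsCongruenceSimple (steinbergAlgebra S C)) : IsEffectiveGroupoid C := by
  classical
  by_contra hne
  obtain ⟨a, ha⟩ := Set.nonempty_iff_ne_empty.2 hne
  obtain ⟨U, hU, haU, hUI⟩ := exists_isCompactOpenBisection isOpen_interior ha
  replace hUI := hUI.trans interior_subset
  have hM : ∀ f ∈ steinbergAlgebra S C,
      ∀ h ∈ {h : Arr C → S | ∀ γ γ', rng γ = rng γ' → h γ = h γ'},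
      convolution f h ∈ {h : Arr C → S | ∀ γ γ', rng γ = rng γ' → h γ = h γ'} := by
    intro f hf h hh γ γ' hγγ'
    induction hf using Submodule.span_induction with
    | mem f hf =>
      obtain ⟨V, hV, rfl⟩ := hf
      by_cases hγ : (rng γ : Arr C) ∈ rngSet V
      · obtain ⟨⟨⟨b, c⟩, hbc⟩, hb, rfl⟩ := exists_comp_eq hγ
        obtain ⟨⟨⟨b', c'⟩, hbc'⟩, hb', rfl⟩ := exists_comp_eq (hγγ' ▸ hγ)
        obtain rfl : b = b' := hV.rng_inj hb hb' hγγ'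
        rw [convolution_indicator_apply hV.toIsOpenBisection _ _ hb,
          convolution_indicator_apply hV.toIsOpenBisection _ _ hb']
        exact hh _ _ (hbc.trans hbc'.symm)
      · rw [convolution_indicator_apply_of_notMem _ hγ,
          convolution_indicator_apply_of_notMem _ (hγγ' ▸ hγ)]
    | zero => rw [zero_convolution]; rfl
    | add f f' hf hf' ih ih' =>
      rw [convolution_add_left hf hf', Pi.add_apply, Pi.add_apply, ih, ih']
    | smul c f hf ih =>
      rw [convolution_smul_left c hf, Pi.smul_apply, Pi.smul_apply, ih]
  have heq : charFn S hU = charFn S hU.rngSet := by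
    refine eq_of_forall_convolution_eq hA hM (h := 1) (fun _ _ _ => rfl) (γ := a) one_ne_zero
      fun h hh => ?_
    funext γ
    refine Eq.trans ?_ (convolution_unit_indicator_apply hU.rngSet.toIsOpenBisection
      (rngSet_subset U) h γ).symm
    split_ifs with hγ
    · obtain ⟨⟨⟨b, c⟩, hbc⟩, hb, rfl⟩ := exists_comp_eq hγ
      refine (convolution_indicator_apply hU.toIsOpenBisection h _ hb).trans (hh _ _ ?_)
      exact hbc.trans (hUI hb).1
    · exact convolution_indicator_apply_of_notMem _ hγ
  have := congrFun (congrArg Subtype.val heq) (rng a : Arr C)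
  rw [charFn_apply_of_mem hU.rngSet ⟨a, haU, rfl⟩,
    charFn_apply_of_notMem hU fun h => (hUI h).2 (rng a).2] at this
  exact zero_ne_one this

end Steinberg

section Converse

variable {S : Type w} [CommSemiring S] {C : Type u} [Groupoid.{v} C] [TopologicalSpace (Arr C)]

/-! ### Compression to a unit neighbourhood in an effective groupoid -/

/-- Every nonempty open set of units contains a nonempty open set `N'` such that a given element of
the Steinberg algebra vanishes on all arrows between points of `N'` that are not units. -/
lemma exists_isOpen_forall_apply_eq_zero [T2Space (Arr C)] [IsAmpleGroupoid C]
    (heff : IsEffectiveGroupoid C) {f : Arr C → S} (hf : f ∈ steinbergAlgebra S C)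
    {N : Set (Arr C)} (hN : IsOpen N) (hne : N.Nonempty) :
    ∃ N' ⊆ N, IsOpen N' ∧ N'.Nonempty ∧ ∀ γ ∉ unitSpace C,
      (src γ : Arr C) ∈ N' → (rng γ : Arr C) ∈ N' → f γ = 0 := by
  have hsc : Continuous fun a : Arr C => (src a : Arr C) :=
    continuous_subtype_val.comp continuous_src
  have hrc : Continuous fun a : Arr C => (rng a : Arr C) :=
    continuous_subtype_val.comp continuous_rng
  induction hf using Submodule.span_induction generalizing N with
  | mem f hf =>
    obtain ⟨U, hU, rfl⟩ := hf
    let O : Set (Arr C) := (U \ unitSpace C) ∩ {a | (src a : Arr C) ∈ N}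
    have hO : IsOpen O := (hU.isOpen.sdiff isClosed_unitSpace).inter (hN.preimage hsc)
    by_cases hOe : O.Nonempty
    · -- Effectiveness yields an arrow of `O` that moves its source away from itself; units near
      -- that source are then moved by `U` out of a neighbourhood of it.
      have : ∃ a ∈ O, src a ≠ rng a := by
        by_contra! hc
        obtain ⟨a, ha⟩ := hOe
        have : a ∈ interior ({γ : Arr C | src γ = rng γ} \ unitSpace C) :=
          interior_maximal (show O ⊆ {γ : Arr C | src γ = rng γ} \ unitSpace C from
            fun b hb => ⟨hc b hb, hb.1.2⟩) hO ha
        rw [heff] at this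
        exact this
      obtain ⟨a, ha, hsr⟩ := this
      obtain ⟨A, B, hA, hB, haA, haB, hAB⟩ := t2_separation (fun h => hsr (Subtype.ext h))
      refine ⟨N ∩ A ∩ (Subtype.val ∘ src) '' (O ∩ {b | (rng b : Arr C) ∈ B}), ?_, ?_, ?_, ?_⟩
      · exact Set.inter_subset_left.trans Set.inter_subset_left
      · exact (hN.inter hA).inter ((isOpen_unitSpace.isOpenMap_subtype_val.comp isOpenMap_src) _
          (hO.inter (hB.preimage hrc)))
      · exact ⟨(src a : Arr C), ⟨ha.2, haA⟩, a, ⟨ha, haB⟩, rfl⟩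
      · rintro γ - ⟨-, b, ⟨hb, hbB⟩, hbγ⟩ ⟨⟨-, hγA⟩, -⟩
        refine Set.indicator_of_notMem (fun hγU => ?_) _
        obtain rfl : b = γ := hU.src_inj hb.1.1 hγU (Subtype.ext hbγ)
        exact Set.disjoint_left.1 hAB hγA hbB
    · refine ⟨N, subset_rfl, hN, hne, fun γ hγ hs _ => Set.indicator_of_notMem (fun hγU => ?_) _⟩
      exact hOe ⟨γ, ⟨hγU, hγ⟩, hs⟩
  | zero => exact ⟨N, subset_rfl, hN, hne, fun _ _ _ _ => rfl⟩
  | add f g _ _ ih ih' =>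
    obtain ⟨N₁, h₁, ho₁, hne₁, hz₁⟩ := ih hN hne
    obtain ⟨N₂, h₂, ho₂, hne₂, hz₂⟩ := ih' ho₁ hne₁
    refine ⟨N₂, h₂.trans h₁, ho₂, hne₂, fun γ hγ hs hr => ?_⟩
    rw [Pi.add_apply, hz₁ γ hγ (h₂ hs) (h₂ hr), hz₂ γ hγ hs hr, add_zero]
  | smul c f _ ih =>
    obtain ⟨N₁, h₁, ho₁, hne₁, hz₁⟩ := ih hN hne
    refine ⟨N₁, h₁, ho₁, hne₁, fun γ hγ hs hr => ?_⟩
    rw [Pi.smul_apply, hz₁ γ hγ hs hr, smul_zero]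

lemma charFn_mul_mul_charFn_eq_smul [IsEtaleGroupoid C] {V : Set (Arr C)}
    (hV : IsCompactOpenBisection V) (hV0 : V ⊆ unitSpace C) (f : steinbergAlgebra S C) {c : S}
    (hc : ∀ γ ∈ V, f.1 γ = c)
    (hf : ∀ γ ∉ unitSpace C, (src γ : Arr C) ∈ V → (rng γ : Arr C) ∈ V → f.1 γ = 0) :
    charFn S hV * f * charFn S hV = c • charFn S hV := by
  classical
  refine Subtype.ext (funext fun γ => ?_)
  change convolution (convolution (V.indicator fun _ => (1 : S)) f.1)
    (V.indicator fun _ => (1 : S)) γ = c * (charFn S hV).1 γ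
  rw [convolution_indicator_unit_apply hV0, convolution_unit_indicator_apply hV.toIsOpenBisection
    hV0]
  by_cases hγ : γ ∈ V
  · rw [coe_src_of_mem (hV0 hγ), coe_rng_of_mem (hV0 hγ), if_pos hγ, if_pos hγ, hc γ hγ,
      charFn_apply_of_mem hV hγ, mul_one]
  · rw [charFn_apply_of_notMem hV hγ, mul_zero]
    split_ifs with hs hr
    · refine hf γ (fun hγ0 => hγ ?_) hs hr
      rwa [coe_src_of_mem hγ0] at hs
    · rfl
    · rfl

/-- In an effective groupoid, two elements of the Steinberg algebra can be compressed
simultaneously to the multiples, by their values at a unit `x`, of the characteristic function of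
an open set of units. That set need not contain `x`. -/
lemma exists_compression [T2Space (Arr C)] [IsAmpleGroupoid C] (heff : IsEffectiveGroupoid C)
    (f g : steinbergAlgebra S C) (x : unitSpace C) :
    ∃ (V : Set (Arr C)) (hV : IsCompactOpenBisection V), V.Nonempty ∧ V ⊆ unitSpace C ∧
      charFn S hV * f * charFn S hV = f.1 x • charFn S hV ∧
      charFn S hV * g * charFn S hV = g.1 x • charFn S hV := by
  obtain ⟨N₁, h₁, ho₁, hne₁, hz₁⟩ := exists_isOpen_forall_apply_eq_zero heff f.2
    (N := unitSpace C ∩ (f.1 ⁻¹' {f.1 x} ∩ g.1 ⁻¹' {g.1 x}))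
    (isOpen_unitSpace.inter (((isLocallyConstant_of_mem f.2).isOpen_fiber _).inter
      ((isLocallyConstant_of_mem g.2).isOpen_fiber _))) ⟨x, x.2, rfl, rfl⟩
  obtain ⟨N₂, h₂, ho₂, ⟨y, hy⟩, hz₂⟩ := exists_isOpen_forall_apply_eq_zero heff g.2 ho₁ hne₁
  obtain ⟨V, hV, hyV, hVN⟩ := exists_isCompactOpenBisection ho₂ hy
  have hV1 : V ⊆ N₁ := hVN.trans h₂
  exact ⟨V, hV, ⟨y, hyV⟩, fun γ hγ => (h₁ (hV1 hγ)).1,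
    charFn_mul_mul_charFn_eq_smul hV (fun γ hγ => (h₁ (hV1 hγ)).1) f
      (fun γ hγ => (h₁ (hV1 hγ)).2.1) fun γ hγ hs hr => hz₁ γ hγ (hV1 hs) (hV1 hr),
    charFn_mul_mul_charFn_eq_smul hV (fun γ hγ => (h₁ (hV1 hγ)).1) g
      (fun γ hγ => (h₁ (hV1 hγ)).2.2) fun γ hγ hs hr => hz₂ γ hγ (hVN hs) (hVN hr)⟩

/-- Distinct elements can be translated by a bisection so that they differ at a unit. -/
lemma exists_charFn_mul_apply_ne [IsAmpleGroupoid C] {f g : steinbergAlgebra S C} (hne : f ≠ g) :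
    ∃ (U : Set (Arr C)) (hU : IsCompactOpenBisection U) (x : unitSpace C),
      (charFn S hU * f).1 x ≠ (charFn S hU * g).1 x := by
  obtain ⟨γ, hγ⟩ : ∃ γ, f.1 γ ≠ g.1 γ := by
    by_contra! h
    exact hne (Subtype.ext (funext h))
  obtain ⟨U, hU, hγU, -⟩ := exists_isCompactOpenBisection isOpen_univ (Set.mem_univ (Arr.inv γ))
  have key : ∀ h : Arr C → S,
      convolution (U.indicator fun _ => (1 : S)) h (src γ : Arr C) = h γ := fun h => by
    rw [← inv_comp_self]
    exact convolution_indicator_apply hU.toIsOpenBisection h ⟨(Arr.inv γ, γ), rfl⟩ hγU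
  refine ⟨U, hU, src γ, ?_⟩
  rw [coe_mul_eq_convolution, coe_mul_eq_convolution]
  exact fun e => hγ ((key f.1).symm.trans (e.trans (key g.1)))

/-! ### The zero class of a congruence in a minimal groupoid -/

lemma charFn_mul_self [IsEtaleGroupoid C] {V : Set (Arr C)} (hV : IsCompactOpenBisection V)
    (hV0 : V ⊆ unitSpace C) : charFn S hV * charFn S hV = charFn S hV := by
  classical
  refine Subtype.ext (funext fun γ => ?_)
  refine (convolution_unit_indicator_apply hV.toIsOpenBisection hV0 _ γ).trans ?_
  split_ifs with hγ
  · rfl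
  · refine (charFn_apply_of_notMem hV fun h => hγ ?_).symm
    rwa [coe_rng_of_mem (hV0 h)]

/-- The congruence on `S` that a congruence `ρ` on the Steinberg algebra induces through the
multiples `a • e` of an idempotent `e`. -/
def coefficientCon [IsEtaleGroupoid C] (ρ : RingCon (steinbergAlgebra S C))
    (e : steinbergAlgebra S C) (he : e * e = e) : RingCon S where
  r a b := ρ (a • e) (b • e)
  iseqv := ⟨fun _ => ρ.refl _, fun h => ρ.symm h, fun h h' => ρ.trans h h'⟩
  add' {a b c d} h h' := by
    rw [add_smul, add_smul]
    exact ρ.add h h'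
  mul' {a b c d} h h' := by
    have key : ∀ a c : S, (a * c) • e = (a • e) * (c • e) := fun a c => by
      rw [smul_mul_smul_comm, he]
    change ρ ((a * c) • e) ((b * d) • e)
    rw [key, key]
    exact ρ.mul h h'

lemma rel_zero_add {R : Type*} [NonUnitalSemiring R] {ρ : RingCon R} {f g : R} (hf : ρ f 0)
    (hg : ρ g 0) : ρ (f + g) 0 := by
  simpa using ρ.add hf hg

lemma rel_zero_mul_left {R : Type*} [NonUnitalSemiring R] {ρ : RingCon R} {f : R} (hf : ρ f 0)
    (g : R) : ρ (g * f) 0 := by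
  simpa using ρ.mul (ρ.refl g) hf

lemma rel_zero_mul_right {R : Type*} [NonUnitalSemiring R] {ρ : RingCon R} {f : R} (hf : ρ f 0)
    (g : R) : ρ (f * g) 0 := by
  simpa using ρ.mul hf (ρ.refl g)

/-- A congruence that is not the equality identifies some nonzero `1_V` with zero. -/
lemma exists_charFn_rel_zero [T2Space (Arr C)] [IsAmpleGroupoid C] (hS : IsCongruenceSimple S)
    (heff : IsEffectiveGroupoid C) (ρ : RingCon (steinbergAlgebra S C))
    {f g : steinbergAlgebra S C} (hne : f ≠ g) (hfg : ρ f g) :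
    ∃ (V : Set (Arr C)) (hV : IsCompactOpenBisection V), V.Nonempty ∧ ρ (charFn S hV) 0 := by
  obtain ⟨U, hU, x, hx⟩ := exists_charFn_mul_apply_ne hne
  obtain ⟨V, hV, hVne, hV0, hf, hg⟩ :=
    exists_compression heff (charFn S hU * f) (charFn S hU * g) x
  have hrel : coefficientCon ρ (charFn S hV) (charFn_mul_self hV hV0)
      ((charFn S hU * f).1 x) ((charFn S hU * g).1 x) := by
    change ρ (_ • _) (_ • _)
    rw [← hf, ← hg]
    exact ρ.mul (ρ.mul (ρ.refl _) (ρ.mul (ρ.refl _) hfg)) (ρ.refl _)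
  have h10 : ρ ((1 : S) • charFn S hV) ((0 : S) • charFn S hV) := hS.rel_of_rel _ hx hrel 1 0
  rw [one_smul, zero_smul] at h10
  exact ⟨V, hV, hVne, h10⟩

/-- If `1_W` is congruent to zero, then so is `1_V` for every compact open `V ⊆ W`. -/
lemma charFn_rel_zero_of_subset [IsEtaleGroupoid C] {ρ : RingCon (steinbergAlgebra S C)}
    {V W : Set (Arr C)} (hV : IsCompactOpenBisection V) (hW : IsCompactOpenBisection W)
    (hVW : V ⊆ W) (h : ρ (charFn S hW) 0) : ρ (charFn S hV) 0 := by
  have := rel_zero_mul_left h (charFn S hV.rngSet)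
  rwa [charFn_mul_charFn,
    charFn_congr (hW.toIsOpenBisection.setMul_rngSet hVW) (hV.rngSet.setMul hW) hV] at this

/-- In a minimal groupoid, if one nonzero `1_V` is congruent to zero, then every arrow has a
neighbourhood `W` with `1_W` congruent to zero: the units that have one form an invariant open
set. -/
lemma exists_mem_charFn_rel_zero [IsAmpleGroupoid C] (hmin : IsMinimalGroupoid C)
    {ρ : RingCon (steinbergAlgebra S C)} {V : Set (Arr C)} (hV : IsCompactOpenBisection V)
    (hne : V.Nonempty) (h : ρ (charFn S hV) 0) (γ : Arr C) :
    ∃ (W : Set (Arr C)) (hW : IsCompactOpenBisection W), γ ∈ W ∧ ρ (charFn S hW) 0 := by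
  let P : Arr C → Prop := fun a =>
    ∃ (W : Set (Arr C)) (hW : IsCompactOpenBisection W), a ∈ W ∧ ρ (charFn S hW) 0
  have hleft : ∀ p : Composable C, P p.1.2 → P (comp p) := by
    rintro p ⟨W, hW, hp, hρ⟩
    obtain ⟨U, hU, hpU, -⟩ := exists_isCompactOpenBisection isOpen_univ (Set.mem_univ p.1.1)
    refine ⟨_, hU.setMul hW, ⟨p, hpU, hp, rfl⟩, ?_⟩
    rw [← charFn_mul_charFn hU hW]
    exact rel_zero_mul_left hρ _
  have hright : ∀ p : Composable C, P p.1.1 → P (comp p) := by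
    rintro p ⟨W, hW, hp, hρ⟩
    obtain ⟨U, hU, hpU, -⟩ := exists_isCompactOpenBisection isOpen_univ (Set.mem_univ p.1.2)
    refine ⟨_, hW.setMul hU, ⟨p, hp, hpU, rfl⟩, ?_⟩
    rw [← charFn_mul_charFn hW hU]
    exact rel_zero_mul_right hρ _
  have hsrc : ∀ a, P a → P (src a : Arr C) := fun a ha => by
    rw [← inv_comp_self]
    exact hleft ⟨(Arr.inv a, a), rfl⟩ ha
  have hrng : ∀ a, P a → P (rng a : Arr C) := fun a ha => by
    rw [← self_comp_inv]
    exact hright ⟨(a, Arr.inv a), rfl⟩ ha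
  have hof : ∀ a, P (src a : Arr C) → P a := fun a ha => by
    have := hleft ⟨(a, (src a : Arr C)), by simp⟩ ha
    rwa [comp_unit] at this
  have hopen : IsOpen {x : unitSpace C | P x} := by
    have : IsOpen {a : Arr C | P a} := isOpen_iff_forall_mem_open.2 fun a ⟨W, hW, ha, hρ⟩ =>
      ⟨W, fun b hb => ⟨W, hW, hb, hρ⟩, hW.isOpen, ha⟩
    exact this.preimage continuous_subtype_val
  obtain ⟨a, ha⟩ := hne
  rcases hmin _ hopen fun a ha => hrng a (hof a ha) with hD | hD
  · have : src a ∈ {x : unitSpace C | P x} := hsrc a ⟨V, hV, ha, h⟩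
    rw [hD] at this
    exact this.elim
  · exact hof γ (show src γ ∈ {x : unitSpace C | P x} from hD ▸ Set.mem_univ _)

/-- If every arrow has a neighbourhood `W` with `1_W` congruent to zero, then everything is
congruent to zero. -/
lemma rel_zero_of_forall_exists [T2Space (Arr C)] [IsAmpleGroupoid C]
    {ρ : RingCon (steinbergAlgebra S C)}
    (h : ∀ γ : Arr C, ∃ (W : Set (Arr C)) (hW : IsCompactOpenBisection W),
      γ ∈ W ∧ ρ (charFn S hW) 0) (f : steinbergAlgebra S C) : ρ f 0 := by
  have hchar : ∀ (U : Set (Arr C)) (hU : IsCompactOpenBisection U), ρ (charFn S hU) 0 := by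
    intro U hU
    have : ∃ (V : Set (Arr C)) (hV : IsCompactOpenBisection V),
        V ⊆ U ∧ U ⊆ V ∧ ρ (charFn S hV) 0 := by
      refine hU.isCompact.induction_on (p := fun K => ∃ (V : Set (Arr C))
        (hV : IsCompactOpenBisection V), V ⊆ U ∧ K ⊆ V ∧ ρ (charFn S hV) 0) ?_ ?_ ?_ ?_
      · have h0 : IsCompactOpenBisection (∅ : Set (Arr C)) :=
          hU.mono (Set.empty_subset _) isOpen_empty isCompact_empty
        refine ⟨∅, h0, Set.empty_subset _, subset_rfl, ?_⟩
        rw [show charFn S h0 = 0 from Subtype.ext (Set.indicator_empty _)]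
        exact ρ.refl 0
      · rintro s t hst ⟨V, hV, hVU, htV, hρ⟩
        exact ⟨V, hV, hVU, hst.trans htV, hρ⟩
      · rintro s t ⟨V, hV, hVU, hsV, hρ⟩ ⟨V', hV', hVU', htV', hρ'⟩
        -- Split `V ∪ V'` into the disjoint sets `V` and `V' \ V`.
        have hd : IsCompactOpenBisection (V' \ V) := hV'.mono Set.sdiff_subset
          (hV'.isOpen.sdiff hV.isCompact.isClosed) (hV'.isCompact.diff hV.isOpen)
        have hu : IsCompactOpenBisection (V ∪ V') := hU.mono (Set.union_subset hVU hVU')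
          (hV.isOpen.union hV'.isOpen) (hV.isCompact.union hV'.isCompact)
        refine ⟨V ∪ V', hu, Set.union_subset hVU hVU', Set.union_subset_union hsV htV', ?_⟩
        have he : charFn S hu = charFn S hV + charFn S hd := by
          refine Subtype.ext ?_
          change (V ∪ V').indicator _ = V.indicator _ + (V' \ V).indicator _
          rw [← Set.union_sdiff_self]
          exact Set.indicator_union_of_disjoint Set.disjoint_sdiff_right _
        rw [he]
        exact rel_zero_add hρ (charFn_rel_zero_of_subset hd hV' Set.sdiff_subset hρ')
      · intro a ha
        obtain ⟨W, hW, haW, hρ⟩ := h a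
        obtain ⟨V, hV, haV, hVUW⟩ :=
          exists_isCompactOpenBisection (hU.isOpen.inter hW.isOpen) ⟨ha, haW⟩
        exact ⟨V, mem_nhdsWithin_of_mem_nhds (hV.isOpen.mem_nhds haV), V, hV,
          hVUW.trans Set.inter_subset_left, subset_rfl,
          charFn_rel_zero_of_subset hV hW (hVUW.trans Set.inter_subset_right) hρ⟩
    obtain ⟨V, hV, hVU, hUV, hρ⟩ := this
    rwa [charFn_congr (hVU.antisymm hUV) hV hU] at hρ
  obtain ⟨f, hf⟩ := f
  induction hf using Submodule.closure_induction with
  | zero => exact ρ.refl 0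
  | add f g hf hg ih ih' => exact rel_zero_add ih ih'
  | smul_mem c f hf =>
    obtain ⟨U, hU, rfl⟩ := hf
    have := rel_zero_mul_left (hchar U hU) (c • charFn S hU.rngSet)
    rwa [smul_mul_assoc, charFn_mul_charFn,
      charFn_congr (hU.toIsOpenBisection.setMul_rngSet subset_rfl) (hU.rngSet.setMul hU) hU] at this

end Converse

end SteinbergSimplicity

/-! ### The characterization of congruence-simplicity -/

/-- The Steinberg algebra of a (nonempty) Hausdorff ample groupoid over a commutative semiring `S`
is congruence-simple iff `S` is a field or the Boolean semifield, and the groupoid is both minimal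
and effective. -/
theorem mainTheorem1 {S : Type*} [CommSemiring S] {C : Type*} [CategoryTheory.Groupoid C]
    [Nonempty C] [TopologicalSpace (Arr C)] [T2Space (Arr C)] [IsAmpleGroupoid C] :
    IsCongruenceSimple (steinbergAlgebra S C) ↔
      (IsFieldSemiring S ∨ Nonempty (S ≃+* BooleanSemifield)) ∧
        (IsMinimalGroupoid C ∧ IsEffectiveGroupoid C) := by
  rw [← isCongruenceSimple_iff_field_or_boolean]
  constructor
  · intro h
    have hS := isCongruenceSimple_coefficients h
    have := hS.1
    exact ⟨hS, isMinimalGroupoid_of_isCongruenceSimple h,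
      isEffectiveGroupoid_of_isCongruenceSimple h⟩
  · rintro ⟨hS, hmin, heff⟩
    have := hS.1
    obtain ⟨U, hU, a, ha⟩ := exists_nonempty_isCompactOpenBisection (C := C)
    have : Nontrivial (steinbergAlgebra S C) := ⟨charFn S hU, 0, fun h => by
      have := congrFun (congrArg Subtype.val h) a
      rw [charFn_apply_of_mem hU ha] at this
      exact one_ne_zero this⟩
    refine isCongruenceSimple_of_rel fun ρ f g hne hfg => ?_
    obtain ⟨V, hV, hVne, hρ⟩ := exists_charFn_rel_zero hS heff ρ hne hfg
    exact rel_zero_of_forall_exists (exists_mem_charFn_rel_zero hmin hV hVne hρ)
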